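/- Let $n>2$ be an integer. Let $\phi:\mathbb{R}^n\to\mathbb{R}$ be a non-negative $C^\infty$ function with compact support $\operatorname{supp}\phi$ such that $0$ is an interior point of $\operatorname{supp}\phi$. Let $f:\mathbb{R}^n\to\mathbb{R}$ be of class $C^\infty$ in a neighbourhood of $\operatorname{supp}\phi$ and real analytic in a neighbourhood of $0$. Suppose that $0$ is a critical point of $f$, that it is the only critical point of $f$ in the interior of $\operatorname{supp}\phi$, and that $f$ has no critical point on the boundary of $\operatorname{supp}\phi$. Suppose also that the critical point $0$ is nondegenerate, i.e. the Hessian matrix of $f$ at $0$ is invertible. For $\tau\in\mathbb{R}$ put $$I(\tau)=\int_{\mathbb{R}^n}e^{i\tau f(x)}\phi(x)\,dx,\qquad X(\tau)=\operatorname{Re}I(\tau),\qquad Y(\tau)=\operatorname{Im}I(\tau),$$ and for $t>0$ put $x(t)=X(1/t)$, $y(t)=Y(1/t)$. Then, for every $\tau_0\in\mathbb{R}$, the plane curve $\Gamma$ parametrized by $\tau\mapsto(X(\tau),Y(\tau))$, $\tau\in[\tau_0,\infty)$, is rectifiable (continuous and of finite length), and the box dimension of $\Gamma$ exists and equals $1$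 (the curve dimension of $I$ is $1$). Furthermore, for every $t_0>0$, the graphs of $x$ and of $y$ over $(0,t_0]$ are rectifiable, and their box dimensions exist and equal $1$ (the oscillatory dimensions of $X$ and $Y$ are $1$). Here the box dimension of a bounded set $A\subset\mathbb{R}^N$ is the common value, if they coincide, of its lower and upper box dimensions $$\inf\Big\{s\ge0:\liminf_{\varepsilon\to0^+}\frac{|A_\varepsilon|}{\varepsilon^{N-s}}=0\Big\},\qquad \inf\Big\{s\ge0:\limsup_{\varepsilon\to0^+}\frac{|A_\varepsilon|}{\varepsilon^{N-s}}=0\Big\},$$ where $A_\varepsilon$ is the open $\varepsilon$-neighbourhood of $A$ and $|A_\varepsilon|$ is its Lebesgue measure. -/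

import Mathlib

open MeasureTheory Filter Topology Set
open scoped ContDiff ENNReal

/-- The oscillatory integral `I(τ) = ∫_{ℝⁿ} e^{iτ f(x)} φ(x) dx` with phase `f` and amplitude `φ`. -/
noncomputable def oscInt {n : ℕ} (f φ : EuclideanSpace ℝ (Fin n) → ℝ) (τ : ℝ) : ℂ :=
  ∫ x, Complex.exp (Complex.I * (τ : ℂ) * (f x : ℂ)) * (φ x : ℂ)

/-- `X(τ) = Re I(τ)`. -/
noncomputable def oscX {n : ℕ} (f φ : EuclideanSpace ℝ (Fin n) → ℝ) (τ : ℝ) : ℝ :=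
  (oscInt f φ τ).re

/-- `Y(τ) = Im I(τ)`. -/
noncomputable def oscY {n : ℕ} (f φ : EuclideanSpace ℝ (Fin n) → ℝ) (τ : ℝ) : ℝ :=
  (oscInt f φ τ).im

/-- The plane curve `τ ↦ (X(τ), Y(τ))` defined by `I`. -/
noncomputable def oscCurve {n : ℕ} (f φ : EuclideanSpace ℝ (Fin n) → ℝ) (τ : ℝ) :
    EuclideanSpace ℝ (Fin 2) :=
  !₂[oscX f φ τ, oscY f φ τ]

/-- For `X : ℝ → ℝ`, the parametrization `t ↦ (t, X(1/t))` of the graph of the reflected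
function `x(t) = X(1/t)`. -/
noncomputable def reflGraph (X : ℝ → ℝ) (t : ℝ) : EuclideanSpace ℝ (Fin 2) :=
  !₂[t, X (1 / t)]

/-- A curve `γ` in the plane, with parameter in `s`, is rectifiable: it is continuous and its length
(the supremum of the lengths of inscribed polygons) is finite. -/
def IsRectifiableCurve (γ : ℝ → EuclideanSpace ℝ (Fin 2)) (s : Set ℝ) : Prop :=
  ContinuousOn γ s ∧ BoundedVariationOn γ s

/-- The Hessian matrix of `f` at `x`. -/
noncomputable def hessianMatrix {n : ℕ} (f : EuclideanSpace ℝ (Fin n) → ℝ)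
    (x : EuclideanSpace ℝ (Fin n)) : Matrix (Fin n) (Fin n) ℝ :=
  Matrix.of fun i j =>
    fderiv ℝ (fderiv ℝ f) x (EuclideanSpace.single i 1) (EuclideanSpace.single j 1)

/-- The standard assumptions on the amplitude `φ`. -/
structure IsStandardAmplitude {n : ℕ} (φ : EuclideanSpace ℝ (Fin n) → ℝ) : Prop where
  contDiff : ContDiff ℝ ∞ φ
  nonneg : ∀ x, 0 ≤ φ x
  hasCompactSupport : HasCompactSupport φ
  zero_mem : (0 : EuclideanSpace ℝ (Fin n)) ∈ interior (tsupport φ)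

/-- The standard assumptions on the phase `f`, with respect to the amplitude `φ`. -/
structure IsStandardPhase {n : ℕ} (f φ : EuclideanSpace ℝ (Fin n) → ℝ) : Prop where
  smooth : ∃ U : Set (EuclideanSpace ℝ (Fin n)),
    IsOpen U ∧ tsupport φ ⊆ U ∧ ContDiffOn ℝ ∞ f U
  analyticAt_zero : AnalyticAt ℝ f 0
  critical_zero : fderiv ℝ f 0 = 0
  eq_zero_of_critical : ∀ x ∈ interior (tsupport φ), fderiv ℝ f x = 0 → x = 0
  not_critical_frontier : ∀ x ∈ frontier (tsupport φ), fderiv ℝ f x ≠ 0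

/-- The quotient `|A_ε| / ε^{N-s}`, where `A_ε` is the open `ε`-neighbourhood of `A ⊆ ℝᴺ`. -/
noncomputable def minkowskiQuotient {N : ℕ} (s : ℝ) (A : Set (EuclideanSpace ℝ (Fin N)))
    (ε : ℝ) : ℝ≥0∞ :=
  volume (Metric.thickening ε A) / ENNReal.ofReal (ε ^ ((N : ℝ) - s))

/-- The lower `s`-dimensional Minkowski content. -/
noncomputable def lowerMinkowskiContent {N : ℕ} (s : ℝ)
    (A : Set (EuclideanSpace ℝ (Fin N))) : ℝ≥0∞ :=
  liminf (minkowskiQuotient s A) (𝓝[>] (0 : ℝ))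

/-- The upper `s`-dimensional Minkowski content. -/
noncomputable def upperMinkowskiContent {N : ℕ} (s : ℝ)
    (A : Set (EuclideanSpace ℝ (Fin N))) : ℝ≥0∞ :=
  limsup (minkowskiQuotient s A) (𝓝[>] (0 : ℝ))

/-- The lower box dimension (of a bounded set). -/
noncomputable def lowerBoxDim {N : ℕ} (A : Set (EuclideanSpace ℝ (Fin N))) : ℝ :=
  sInf {s : ℝ | 0 ≤ s ∧ lowerMinkowskiContent s A = 0}

/-- The upper box dimension (of a bounded set). -/
noncomputable def upperBoxDim {N : ℕ} (A : Set (EuclideanSpace ℝ (Fin N))) : ℝ :=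
  sInf {s : ℝ | 0 ≤ s ∧ upperMinkowskiContent s A = 0}

/-- The set `A` is bounded, its box dimension exists, and it is equal to `d`. -/
def HasBoxDim {N : ℕ} (A : Set (EuclideanSpace ℝ (Fin N))) (d : ℝ) : Prop :=
  Bornology.IsBounded A ∧ lowerBoxDim A = d ∧ upperBoxDim A = d

/-- The oscillatory dimension of `X` near `∞` is `d`: the graph of `x(t) = X(1/t)` near `t = 0`,
over any interval `(0, t₀]`, has box dimension `d`. -/
def HasOscDim (X : ℝ → ℝ) (d : ℝ) : Prop :=
  ∀ t₀ : ℝ, 0 < t₀ → HasBoxDim (reflGraph X '' Ioc 0 t₀) d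

/-- The curve dimension of the oscillatory integral with phase `f` and amplitude `φ` is `d`: the
curve near `τ = ∞`, over any half-line `[τ₀, ∞)`, has box dimension `d`. -/
def HasCurveDim {n : ℕ} (f φ : EuclideanSpace ℝ (Fin n) → ℝ) (d : ℝ) : Prop :=
  ∀ τ₀ : ℝ, HasBoxDim (oscCurve f φ '' Ici τ₀) d

/-!
The oscillatory integral `I` has derivative `I'(τ) = i ∫ e^{iτf} f φ`, again an oscillatory integral
with phase `f`. If `∇f` vanishes only at a nondegenerate critical point, and `n > 2`, such integrals
are `O(τ ^ (-5/4))` (`exists_norm_integral_cexp_phase_le_rpow`). Hence `I'` is integrable on every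
half-line, so that the curve `τ ↦ I(τ)`, and with it the graphs of the reflected functions, have
finite length.

A rectifiable curve which is not a point has box dimension `1`
(`IsRectifiableCurve.hasBoxDim_one`): finite length covers it by `O(1/ε)` balls of radius `ε`, and
connectedness puts a constant times `1/ε` disjoint such balls in its `ε`-neighbourhood. The graphs
clearly have two points. The curve of `I` has two points on every half-line, because a constant `I`
would be equal to its limit `0` there, hence to `0` everywhere as `I` is entire, whereas
`I(0) = ∫ φ > 0`.

The decay does not need the Morse lemma. With the weight `w = 1 / (|∇f|² + 1/τ)`, integration by
parts along the vector field `w ∇f` gives `iτ ∫ e^{iτf} u = ∫ e^{iτf} w (a u - D u)`, where `D` is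
the derivative along `∇f` and `a = i + w D(|∇f|²) - Δf` (`integral_cexp_phase_mul`). Since
`D(|∇f|²)` and `D²(|∇f|²)` are `O(|∇f|²)`, everything but the weight stays bounded uniformly in `τ`,
and two such steps give `τ² |∫ e^{iτf} u| ≤ C ∫ w²`. At a nondegenerate critical point
`|∇f| ≥ c ‖x‖`, so `w² ≤ C τ ^ (3/4) ‖x‖ ^ (-5/2)`, which is locally integrable in dimension
greater than two.
-/

/-! ### Curves of bounded variation -/

theorem eVariationOn_le_add {α E F G : Type*} [LinearOrder α] [PseudoEMetricSpace E]
    [PseudoEMetricSpace F] [PseudoEMetricSpace G] {γ : α → E} {a : α → F} {b : α → G} {s : Set α}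
    (h : ∀ x ∈ s, ∀ y ∈ s, edist (γ x) (γ y) ≤ edist (a x) (a y) + edist (b x) (b y)) :
    eVariationOn γ s ≤ eVariationOn a s + eVariationOn b s := by
  refine iSup_le ?_
  rintro ⟨n, u, hu, us⟩
  refine (Finset.sum_le_sum fun i _ => h _ (us (i + 1)) _ (us i)).trans ?_
  rw [Finset.sum_add_distrib]
  exact add_le_add (eVariationOn.sum_le hu us) (eVariationOn.sum_le hu us)

theorem BoundedVariationOn.of_edist_le {α E F : Type*} [LinearOrder α] [PseudoEMetricSpace E]
    [PseudoEMetricSpace F] {γ : α → E} {a : α → F} {s : Set α} (ha : BoundedVariationOn a s)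
    (h : ∀ x ∈ s, ∀ y ∈ s, edist (γ x) (γ y) ≤ edist (a x) (a y)) :
    BoundedVariationOn γ s := by
  refine ne_top_of_le_ne_top (ENNReal.add_ne_top.2 ⟨ha, ha⟩)
    (eVariationOn_le_add (a := a) (b := a) fun x hx y hy => (h x hx y hy).trans le_self_add)

theorem MonotoneOn.boundedVariationOn_of_abs_le {m : ℝ → ℝ} {s : Set ℝ} (hm : MonotoneOn m s)
    {C : ℝ} (hC : ∀ x ∈ s, |m x| ≤ C) : BoundedVariationOn m s := by
  refine ne_top_of_le_ne_top (b := ENNReal.ofReal (2 * C)) ENNReal.ofReal_ne_top ?_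
  refine iSup_le ?_
  rintro ⟨n, u, hu, us⟩
  have h1 : ∀ i ∈ Finset.range n, edist (m (u (i + 1))) (m (u i)) =
      ENNReal.ofReal (m (u (i + 1)) - m (u i)) := fun i _ => by
    rw [edist_dist, Real.dist_eq, abs_of_nonneg]
    exact sub_nonneg.2 (hm (us i) (us (i + 1)) (hu (Nat.le_succ i)))
  dsimp only
  rw [Finset.sum_congr rfl h1, ← ENNReal.ofReal_sum_of_nonneg, Finset.sum_range_sub
    (fun i => m (u i))]
  · refine ENNReal.ofReal_le_ofReal ?_
    have := abs_le.1 (hC _ (us n))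
    have := abs_le.1 (hC _ (us 0))
    linarith
  · exact fun i _ => sub_nonneg.2 (hm (us i) (us (i + 1)) (hu (Nat.le_succ i)))

/-- A curve that is Lipschitz with respect to a bounded monotone change of parameter is covered, for
every `ε`, by `O(1/ε)` balls of radius `ε`. The variation of the curve up to a given parameter is
such a change of parameter. -/
theorem BoundedVariationOn.exists_volume_thickening_le {γ : ℝ → EuclideanSpace ℝ (Fin 2)}
    {s : Set ℝ} (h : BoundedVariationOn γ s) :
    ∃ C : ℝ≥0∞, C ≠ ⊤ ∧ ∀ ε : ℝ, 0 < ε → ε ≤ 1 →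
      volume (Metric.thickening ε (γ '' s)) ≤ C * ENNReal.ofReal ε := by
  classical
  set V : ℝ := (eVariationOn γ s).toReal
  have hV : 0 ≤ V := ENNReal.toReal_nonneg
  have hfin : ∀ b, eVariationOn γ (s ∩ Iic b) ≠ ⊤ := fun b => h.mono inter_subset_left
  -- the length of the curve up to the parameter `b`
  set m : ℝ → ℝ := fun b => (eVariationOn γ (s ∩ Iic b)).toReal with hm
  have hm0 : ∀ b, 0 ≤ m b := fun b => ENNReal.toReal_nonneg
  have hmV : ∀ b, m b ≤ V := fun b =>
    ENNReal.toReal_mono h (eVariationOn.mono _ inter_subset_left)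
  have hle : ∀ a ∈ s, ∀ b ∈ s, a ≤ b → dist (γ a) (γ b) ≤ m b - m a := by
    intro a ha b hb hab
    have h1 : eVariationOn γ (s ∩ Iic a) + edist (γ a) (γ b) ≤ eVariationOn γ (s ∩ Iic b) :=
      calc _ ≤ eVariationOn γ (s ∩ Iic a) + eVariationOn γ (s ∩ Icc a b) := by
            gcongr
            exact eVariationOn.edist_le γ ⟨ha, left_mem_Icc.2 hab⟩ ⟨hb, right_mem_Icc.2 hab⟩
        _ ≤ eVariationOn γ ((s ∩ Iic a) ∪ (s ∩ Icc a b)) :=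
            eVariationOn.add_le_union γ fun x hx y hy => hx.2.trans hy.2.1
        _ ≤ _ := eVariationOn.mono _ (union_subset
            (inter_subset_inter_right _ (Iic_subset_Iic.2 hab))
            (inter_subset_inter_right _ Icc_subset_Iic_self))
    have h2 := ENNReal.toReal_mono (hfin b) h1
    rw [ENNReal.toReal_add (hfin a) (edist_ne_top _ _), ← dist_edist] at h2
    simp only [hm]
    linarith
  have hdist : ∀ a ∈ s, ∀ b ∈ s, dist (γ a) (γ b) ≤ |m a - m b| := by
    intro a ha b hb
    rcases le_total a b with hab | hab
    · rw [abs_sub_comm]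
      exact (hle a ha b hb hab).trans (le_abs_self _)
    · rw [dist_comm]
      exact (hle b hb a ha hab).trans (le_abs_self _)
  set v : ℝ≥0∞ := volume (Metric.ball (0 : EuclideanSpace ℝ (Fin 2)) 1)
  have hv : v ≠ ⊤ := measure_ball_lt_top.ne
  refine ⟨ENNReal.ofReal (4 * (V + 1)) * v, ENNReal.mul_ne_top ENNReal.ofReal_ne_top hv, ?_⟩
  intro ε hε hε1
  -- one centre for each value of `⌊m / ε⌋`
  have hp : ∀ k : ℕ, ∃ p, ∀ x ∈ s, ⌊m x / ε⌋₊ = k → dist (γ x) p < ε := by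
    intro k
    by_cases hk : ∃ y ∈ s, ⌊m y / ε⌋₊ = k
    · obtain ⟨y, hy, hyk⟩ := hk
      refine ⟨γ y, fun x hx hxk => (hdist x hx y hy).trans_lt ?_⟩
      have hx1 := Nat.floor_le (div_nonneg (hm0 x) hε.le)
      have hx2 := Nat.lt_floor_add_one (m x / ε)
      have hy1 := Nat.floor_le (div_nonneg (hm0 y) hε.le)
      have hy2 := Nat.lt_floor_add_one (m y / ε)
      rw [hxk] at hx1 hx2
      rw [hyk] at hy1 hy2
      have : |m x / ε - m y / ε| < 1 := by
        rw [abs_lt]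
        constructor <;> linarith
      rwa [← sub_div, abs_div, abs_of_pos hε, div_lt_one hε] at this
    · push Not at hk
      exact ⟨0, fun x hx hxk => absurd hxk (hk x hx)⟩
  choose p hp using hp
  have hcov : Metric.thickening ε (γ '' s) ⊆
      ⋃ k ∈ Finset.range (⌊V / ε⌋₊ + 1), Metric.ball (p k) (2 * ε) := by
    intro z hz
    obtain ⟨_, ⟨x, hx, rfl⟩, hzx⟩ := Metric.mem_thickening_iff.1 hz
    refine mem_iUnion₂.2 ⟨⌊m x / ε⌋₊, ?_, ?_⟩
    · rw [Finset.mem_range, Nat.lt_succ_iff]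
      exact Nat.floor_le_floor (div_le_div_of_nonneg_right (hmV x) hε.le)
    · rw [Metric.mem_ball]
      linarith [dist_triangle z (γ x) (p ⌊m x / ε⌋₊), hp _ x hx rfl]
  calc volume (Metric.thickening ε (γ '' s))
      ≤ ∑ k ∈ Finset.range (⌊V / ε⌋₊ + 1), volume (Metric.ball (p k) (2 * ε)) :=
        (measure_mono hcov).trans (measure_biUnion_finset_le _ _)
    _ = ENNReal.ofReal ((⌊V / ε⌋₊ + 1 : ℕ) * (2 * ε) ^ 2) * v := by
        rw [Finset.sum_congr rfl fun k _ => Measure.addHaar_ball volume (p k) (by positivity)]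
        rw [Finset.sum_const, Finset.card_range, nsmul_eq_mul, finrank_euclideanSpace_fin,
          ENNReal.ofReal_mul (by positivity), ENNReal.ofReal_natCast, mul_assoc]
    _ ≤ ENNReal.ofReal (4 * (V + 1) * ε) * v := by
        refine mul_le_mul_left (ENNReal.ofReal_le_ofReal ?_) v
        have h1 : (⌊V / ε⌋₊ : ℝ) * ε ≤ V :=
          (le_div_iff₀ hε).1 (Nat.floor_le (div_nonneg hV hε.le))
        push_cast
        nlinarith [mul_le_mul_of_nonneg_right (add_le_add h1 hε1) hε.le]
    _ = ENNReal.ofReal (4 * (V + 1)) * v * ENNReal.ofReal ε := by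
        rw [ENNReal.ofReal_mul (by positivity)]
        ring

/-- The `ε`-neighbourhood of a connected plane set with two points contains `d/(2ε)` disjoint balls
of radius `ε`, centred at points whose coordinates in one direction differ by multiples of `2ε`. -/
theorem IsPreconnected.exists_le_volume_thickening {A : Set (EuclideanSpace ℝ (Fin 2))}
    (hA : IsPreconnected A) (hnt : A.Nontrivial) :
    ∃ c : ℝ≥0∞, c ≠ 0 ∧ ∀ ε : ℝ, 0 < ε →
      c * ENNReal.ofReal ε ≤ volume (Metric.thickening ε A) := by
  obtain ⟨p, hp, q, hq, hpq⟩ := hnt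
  obtain ⟨i, hi⟩ : ∃ i, p i ≠ q i := by
    by_contra! hcon
    exact hpq (by ext i; exact hcon i)
  wlog hlt : p i < q i generalizing p q
  · exact this q hq p hp hpq.symm hi.symm (lt_of_le_of_ne (not_lt.1 hlt) hi.symm)
  set d := q i - p i
  have hd : 0 < d := sub_pos.2 hlt
  set v : ℝ≥0∞ := volume (Metric.ball (0 : EuclideanSpace ℝ (Fin 2)) 1)
  have hv : v ≠ 0 := (Metric.measure_ball_pos _ _ one_pos).ne'
  refine ⟨ENNReal.ofReal (d / 2) * v, mul_ne_zero (by simpa using hd) hv, fun ε hε => ?_⟩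
  have hsurj : ∀ k : ℕ, k ≤ ⌊d / (2 * ε)⌋₊ → ∃ z ∈ A, z i = p i + 2 * ε * k := by
    intro k hk
    have hk' : (k : ℝ) * (2 * ε) ≤ d := (le_div_iff₀ (by positivity)).1
      ((Nat.cast_le.2 hk).trans (Nat.floor_le (by positivity)))
    have hc : ContinuousOn (fun z : EuclideanSpace ℝ (Fin 2) => z i) A := by fun_prop
    refine hA.intermediate_value hp hq hc ⟨?_, ?_⟩
    · have : 0 ≤ 2 * ε * k := by positivity
      linarith
    · simp only [d] at hk'
      linarith
  choose! z hzA hz using hsurj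
  set N := ⌊d / (2 * ε)⌋₊ + 1
  have hdisj : (Finset.range N : Set ℕ).PairwiseDisjoint fun k => Metric.ball (z k) ε := by
    intro k hk l hl hkl
    refine Metric.ball_disjoint_ball ?_
    have hk' := hz k (Nat.lt_succ_iff.1 (Finset.mem_range.1 hk))
    have hl' := hz l (Nat.lt_succ_iff.1 (Finset.mem_range.1 hl))
    have h1 : |z k i - z l i| ≤ dist (z k) (z l) := by
      rw [dist_eq_norm]
      exact PiLp.norm_apply_le (z k - z l) i
    rw [hk', hl'] at h1
    have h2 : (1 : ℝ) ≤ |(k : ℝ) - l| := by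
      have : (1 : ℤ) ≤ |(k : ℤ) - l| := Int.one_le_abs (sub_ne_zero.2 (by exact_mod_cast hkl))
      exact_mod_cast this
    have h3 : p i + 2 * ε * k - (p i + 2 * ε * l) = 2 * ε * (k - l) := by ring
    rw [h3, abs_mul, abs_of_pos (by positivity : 0 < 2 * ε)] at h1
    nlinarith
  calc ENNReal.ofReal (d / 2) * v * ENNReal.ofReal ε
      = ENNReal.ofReal (d / 2 * ε) * v := by
        rw [ENNReal.ofReal_mul (by positivity)]
        ring
    _ ≤ ENNReal.ofReal (N * ε ^ 2) * v := by
        refine mul_le_mul_left (ENNReal.ofReal_le_ofReal ?_) v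
        have h1 : d < N * (2 * ε) := (div_lt_iff₀ (by positivity)).1 (by
          simpa [N] using Nat.lt_floor_add_one (d / (2 * ε)))
        nlinarith [mul_lt_mul_of_pos_right h1 hε]
    _ = ∑ k ∈ Finset.range N, volume (Metric.ball (z k) ε) := by
        rw [Finset.sum_congr rfl fun k _ => Measure.addHaar_ball volume (z k) hε.le]
        rw [Finset.sum_const, Finset.card_range, nsmul_eq_mul, finrank_euclideanSpace_fin,
          ENNReal.ofReal_mul (by positivity), ENNReal.ofReal_natCast, mul_assoc]
    _ = volume (⋃ k ∈ Finset.range N, Metric.ball (z k) ε) :=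
        (measure_biUnion_finset hdisj fun k _ => Metric.isOpen_ball.measurableSet).symm
    _ ≤ volume (Metric.thickening ε A) := by
        refine measure_mono (iUnion₂_subset fun k hk => ?_)
        exact Metric.ball_subset_thickening
          (hzA k (Nat.lt_succ_iff.1 (Finset.mem_range.1 hk))) ε

/-- A bounded plane set whose `ε`-neighbourhoods have area comparable to `ε` has box
dimension `1`. -/
theorem hasBoxDim_one_of_volume_thickening {A : Set (EuclideanSpace ℝ (Fin 2))}
    (hA : Bornology.IsBounded A) {c C : ℝ≥0∞} (hc : c ≠ 0) (hC : C ≠ ⊤)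
    (hlow : ∀ ε : ℝ, 0 < ε → c * ENNReal.ofReal ε ≤ volume (Metric.thickening ε A))
    (hup : ∀ ε : ℝ, 0 < ε → ε ≤ 1 → volume (Metric.thickening ε A) ≤ C * ENNReal.ofReal ε) :
    HasBoxDim A 1 := by
  have hev : ∀ᶠ ε : ℝ in 𝓝[>] 0, ε ∈ Ioc (0 : ℝ) 1 :=
    Ioc_mem_nhdsGT one_pos
  have hdiv : ∀ (s ε : ℝ), 0 < ε →
      ENNReal.ofReal ε / ENNReal.ofReal (ε ^ (((2 : ℕ) : ℝ) - s)) =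
        ENNReal.ofReal (ε ^ (s - 1)) := by
    intro s ε hε
    rw [← ENNReal.ofReal_div_of_pos (by positivity)]
    congr 1
    nth_rewrite 1 [← Real.rpow_one ε]
    rw [← Real.rpow_sub hε]
    congr 1
    push_cast
    ring
  have hlower : ∀ s : ℝ, s < 1 → lowerMinkowskiContent s A ≠ 0 := by
    intro s hs h0
    have : c ≤ lowerMinkowskiContent s A := by
      refine le_liminf_of_le (by isBoundedDefault) ?_
      filter_upwards [hev] with ε hε
      calc c ≤ c * ENNReal.ofReal (ε ^ (s - 1)) := by
            refine le_mul_of_one_le_right' ?_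
            rw [ENNReal.one_le_ofReal]
            exact Real.one_le_rpow_of_pos_of_le_one_of_nonpos hε.1 hε.2 (by linarith)
        _ = c * ENNReal.ofReal ε / ENNReal.ofReal (ε ^ (((2 : ℕ) : ℝ) - s)) := by
            rw [mul_div_assoc, hdiv s ε hε.1]
        _ ≤ minkowskiQuotient s A ε := ENNReal.div_le_div_right (hlow ε hε.1) _
    rw [h0] at this
    exact hc (le_antisymm this zero_le)
  have hupper : ∀ s : ℝ, 1 < s → upperMinkowskiContent s A = 0 := by
    intro s hs
    refine Tendsto.limsup_eq ?_
    have h1 : Tendsto (fun ε : ℝ => C * ENNReal.ofReal (ε ^ (s - 1))) (𝓝[>] 0) (𝓝 0) := by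
      have h2 : Tendsto (fun ε : ℝ => ε ^ (s - 1)) (𝓝[>] 0) (𝓝 0) := by
        have := (Real.continuousAt_rpow_const (0 : ℝ) (s - 1) (Or.inr (by linarith))).tendsto
        rw [Real.zero_rpow (by linarith)] at this
        exact this.mono_left nhdsWithin_le_nhds
      have h3 := ENNReal.Tendsto.const_mul (ENNReal.tendsto_ofReal h2) (Or.inr hC)
      simpa using h3
    refine tendsto_of_tendsto_of_tendsto_of_le_of_le' tendsto_const_nhds h1
      (Eventually.of_forall fun _ => zero_le) ?_
    filter_upwards [hev] with ε hε
    rw [← hdiv s ε hε.1, ← mul_div_assoc]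
    exact ENNReal.div_le_div_right (hup ε hε.1 hε.2) _
  have hle : ∀ s, lowerMinkowskiContent s A ≤ upperMinkowskiContent s A := fun s => liminf_le_limsup
  have key : ∀ S : Set ℝ, S ⊆ Ici 1 → Ioi 1 ⊆ S → sInf S = 1 := by
    intro S h1 h2
    refine le_antisymm ?_ (le_csInf ⟨2, h2 (by norm_num)⟩ fun s hs => h1 hs)
    refine le_of_forall_gt_imp_ge_of_dense fun a ha => ?_
    exact csInf_le ⟨1, fun s hs => h1 hs⟩ (h2 ha)
  refine ⟨hA, key _ ?_ ?_, key _ ?_ ?_⟩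
  · exact fun s hs => not_lt.1 fun h => hlower s h hs.2
  · exact fun s hs =>
      ⟨by linarith [mem_Ioi.1 hs], le_antisymm ((hle s).trans (hupper s hs).le) zero_le⟩
  · exact fun s hs => not_lt.1 fun h => hlower s h (le_antisymm ((hle s).trans hs.2.le) zero_le)
  · exact fun s hs => ⟨by linarith [mem_Ioi.1 hs], hupper s hs⟩

theorem BoundedVariationOn.isBounded_image {γ : ℝ → EuclideanSpace ℝ (Fin 2)} {s : Set ℝ}
    (h : BoundedVariationOn γ s) : Bornology.IsBounded (γ '' s) := by
  refine Metric.isBounded_iff.2 ⟨(eVariationOn γ s).toReal, ?_⟩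
  rintro _ ⟨x, hx, rfl⟩ _ ⟨y, hy, rfl⟩
  exact h.dist_le hx hy

/-- A rectifiable curve that is not reduced to a point has box dimension `1`. -/
theorem IsRectifiableCurve.hasBoxDim_one {γ : ℝ → EuclideanSpace ℝ (Fin 2)} {s : Set ℝ}
    (h : IsRectifiableCurve γ s) (hs : IsPreconnected s) (hnt : (γ '' s).Nontrivial) :
    HasBoxDim (γ '' s) 1 := by
  obtain ⟨C, hC, hup⟩ := h.2.exists_volume_thickening_le
  obtain ⟨c, hc, hlow⟩ := (hs.image γ h.1).exists_le_volume_thickening hnt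
  exact hasBoxDim_one_of_volume_thickening h.2.isBounded_image hc hC hlow hup

/-! ### Integration by parts along a vector field -/

/-- The derivative of a complex function `u` along the vector field `F`. -/
noncomputable def dirDeriv {n : ℕ}
    (F : EuclideanSpace ℝ (Fin n) → EuclideanSpace ℝ (Fin n))
    (u : EuclideanSpace ℝ (Fin n) → ℂ) (x : EuclideanSpace ℝ (Fin n)) : ℂ :=
  fderiv ℝ u x (F x)

/-- The divergence of the vector field `F`, as a complex number. -/
noncomputable def divergence {n : ℕ}
    (F : EuclideanSpace ℝ (Fin n) → EuclideanSpace ℝ (Fin n))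
    (x : EuclideanSpace ℝ (Fin n)) : ℂ :=
  ∑ j, fderiv ℝ (fun y => ((F y j : ℝ) : ℂ)) x (EuclideanSpace.single j 1)

section VectorField

variable {n : ℕ} {F : EuclideanSpace ℝ (Fin n) → EuclideanSpace ℝ (Fin n)}
  {u v : EuclideanSpace ℝ (Fin n) → ℂ} {x : EuclideanSpace ℝ (Fin n)}

theorem dirDeriv_add (hu : DifferentiableAt ℝ u x) (hv : DifferentiableAt ℝ v x) :
    dirDeriv F (fun y => u y + v y) x = dirDeriv F u x + dirDeriv F v x := by
  simp [dirDeriv, fderiv_fun_add hu hv]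

theorem dirDeriv_sub (hu : DifferentiableAt ℝ u x) (hv : DifferentiableAt ℝ v x) :
    dirDeriv F (fun y => u y - v y) x = dirDeriv F u x - dirDeriv F v x := by
  simp [dirDeriv, fderiv_fun_sub hu hv]

theorem dirDeriv_mul (hu : DifferentiableAt ℝ u x) (hv : DifferentiableAt ℝ v x) :
    dirDeriv F (fun y => u y * v y) x = u x * dirDeriv F v x + v x * dirDeriv F u x := by
  simp [dirDeriv, fderiv_fun_mul hu hv]

theorem dirDeriv_const (c : ℂ) : dirDeriv F (fun _ => c) x = 0 := by
  simp [dirDeriv]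

theorem dirDeriv_inv (hu : DifferentiableAt ℝ u x) (hux : ∀ y, u y ≠ 0) :
    dirDeriv F (fun y => (u y)⁻¹) x = -((u x)⁻¹ ^ 2 * dirDeriv F u x) := by
  have hinv : DifferentiableAt ℝ (fun y => (u y)⁻¹) x := hu.inv (hux x)
  have h1 := dirDeriv_mul (F := F) hu hinv
  have h2 : (fun y => u y * (u y)⁻¹) = fun _ => 1 := funext fun y => mul_inv_cancel₀ (hux y)
  rw [h2, dirDeriv_const] at h1
  have h3 := hux x
  field_simp
  field_simp at h1
  linear_combination -h1

theorem ContDiff.dirDeriv (hF : ContDiff ℝ ∞ F) (hu : ContDiff ℝ ∞ u) :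
    ContDiff ℝ ∞ (dirDeriv F u) :=
  (hu.fderiv_right (m := ∞) le_rfl).clm_apply hF

theorem ContDiff.divergence (hF : ContDiff ℝ ∞ F) : ContDiff ℝ ∞ (divergence F) := by
  refine ContDiff.sum fun j _ => ContDiff.clm_apply ?_ contDiff_const
  refine ContDiff.fderiv_right (m := ∞) ?_ le_rfl
  exact Complex.ofRealCLM.contDiff.comp (contDiff_euclidean.1 hF j)

theorem dirDeriv_eq_zero_of_notMem_tsupport (hx : x ∉ tsupport u) : dirDeriv F u x = 0 := by
  have : fderiv ℝ u x = 0 :=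
    image_eq_zero_of_notMem_tsupport fun h => hx (tsupport_fderiv_subset ℝ h)
  simp [dirDeriv, this]

theorem tsupport_dirDeriv_subset : tsupport (dirDeriv F u) ⊆ tsupport u :=
  closure_minimal (fun _ hx => by_contra fun h => hx (dirDeriv_eq_zero_of_notMem_tsupport h))
    (isClosed_tsupport _)

/-- The divergence theorem for the compactly supported vector field `u F`. -/
theorem integral_dirDeriv_add_mul_divergence (hF : ContDiff ℝ ∞ F) (hu : ContDiff ℝ ∞ u)
    (hc : HasCompactSupport u) :
    ∫ x, (dirDeriv F u x + u x * divergence F x) = 0 := by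
  set e : Fin n → EuclideanSpace ℝ (Fin n) := fun j => EuclideanSpace.single j 1
  set Fc : Fin n → EuclideanSpace ℝ (Fin n) → ℂ := fun j y => ((F y j : ℝ) : ℂ)
  have hFc : ∀ j, ContDiff ℝ ∞ (Fc j) := fun j =>
    Complex.ofRealCLM.contDiff.comp (contDiff_euclidean.1 hF j)
  have hdu : ∀ j, Continuous fun x => fderiv ℝ u x (e j) := fun j =>
    (hu.continuous_fderiv (by simp)).clm_apply continuous_const
  have hdF : ∀ j, Continuous fun x => fderiv ℝ (Fc j) x (e j) := fun j =>
    ((hFc j).continuous_fderiv (by simp)).clm_apply continuous_const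
  have hcu : ∀ j, HasCompactSupport fun x => fderiv ℝ u x (e j) := fun j =>
    hc.fderiv_apply ℝ (e j)
  have h1 : ∀ j, Integrable fun x => fderiv ℝ u x (e j) * Fc j x := fun j =>
    ((hdu j).mul (hFc j).continuous).integrable_of_hasCompactSupport (hcu j).mul_right
  have h2 : ∀ j, Integrable fun x => u x * fderiv ℝ (Fc j) x (e j) := fun j =>
    (hu.continuous.mul (hdF j)).integrable_of_hasCompactSupport hc.mul_right
  have h3 : ∀ j, Integrable fun x => u x * Fc j x := fun j =>
    (hu.continuous.mul (hFc j).continuous).integrable_of_hasCompactSupport hc.mul_right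
  have hpt : ∀ x, dirDeriv F u x + u x * divergence F x =
      ∑ j, (fderiv ℝ u x (e j) * Fc j x + u x * fderiv ℝ (Fc j) x (e j)) := by
    intro x
    rw [Finset.sum_add_distrib, divergence, Finset.mul_sum]
    congr 1
    have hFx : F x = ∑ j, F x j • e j := by
      simpa [e] using ((EuclideanSpace.basisFun (Fin n) ℝ).sum_repr (F x)).symm
    rw [dirDeriv]
    conv_lhs => rw [hFx]
    simp [Fc, mul_comm]
  simp_rw [hpt]
  rw [integral_finsetSum _ fun j _ => (h1 j).fun_add (h2 j)]
  refine Finset.sum_eq_zero fun j _ => ?_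
  rw [integral_add (h1 j) (h2 j), integral_mul_fderiv_eq_neg_fderiv_mul_of_integrable (h1 j) (h2 j)
    (h3 j) (fun x _ => (hu.differentiable (by simp)) x)
    (fun x _ => ((hFc j).differentiable (by simp)) x), add_neg_cancel]

theorem dirDeriv_inner {A B : EuclideanSpace ℝ (Fin n) → EuclideanSpace ℝ (Fin n)}
    (hA : DifferentiableAt ℝ A x) (hB : DifferentiableAt ℝ B x) :
    dirDeriv F (fun y => ((inner ℝ (A y) (B y) : ℝ) : ℂ)) x =
      ((inner ℝ (A x) (fderiv ℝ B x (F x)) + inner ℝ (fderiv ℝ A x (F x)) (B x) : ℝ) : ℂ) := by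
  have h := (hA.inner ℝ hB).hasFDerivAt
  have h' := (Complex.ofRealCLM.hasFDerivAt (x := (inner ℝ (A x) (B x) : ℝ))).comp x h
  have h'' : fderiv ℝ (fun y => ((inner ℝ (A y) (B y) : ℝ) : ℂ)) x = _ := h'.fderiv
  rw [dirDeriv, h'']
  simp [fderiv_inner_apply ℝ hA hB]

end VectorField

/-! ### The method of stationary phase -/

/-- The squared length of the vector field `F`, as a complex number. -/
noncomputable def normSqField {n : ℕ}
    (F : EuclideanSpace ℝ (Fin n) → EuclideanSpace ℝ (Fin n))
    (x : EuclideanSpace ℝ (Fin n)) : ℂ :=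
  ((inner ℝ (F x) (F x) : ℝ) : ℂ)

/-- The weight `1 / (|F|² + 1/τ)`. -/
noncomputable def phaseWeight {n : ℕ}
    (F : EuclideanSpace ℝ (Fin n) → EuclideanSpace ℝ (Fin n)) (τ : ℝ)
    (x : EuclideanSpace ℝ (Fin n)) : ℂ :=
  (normSqField F x + ((1 / τ : ℝ) : ℂ))⁻¹

/-- The zeroth order coefficient `i + w D(|F|²) - div F` of the first order operator that an
integration by parts moves onto the amplitude. -/
noncomputable def phaseCoeff {n : ℕ}
    (F : EuclideanSpace ℝ (Fin n) → EuclideanSpace ℝ (Fin n)) (τ : ℝ)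
    (x : EuclideanSpace ℝ (Fin n)) : ℂ :=
  Complex.I + phaseWeight F τ x * dirDeriv F (normSqField F) x - divergence F x

section StationaryPhase

variable {n : ℕ} {F : EuclideanSpace ℝ (Fin n) → EuclideanSpace ℝ (Fin n)}
  {f : EuclideanSpace ℝ (Fin n) → ℝ} {u : EuclideanSpace ℝ (Fin n) → ℂ} {τ : ℝ}
  {K : Set (EuclideanSpace ℝ (Fin n))}

theorem normSqField_add_eq (F : EuclideanSpace ℝ (Fin n) → EuclideanSpace ℝ (Fin n)) (τ : ℝ)
    (x : EuclideanSpace ℝ (Fin n)) :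
    normSqField F x + ((1 / τ : ℝ) : ℂ) = ((‖F x‖ ^ 2 + 1 / τ : ℝ) : ℂ) := by
  rw [normSqField, real_inner_self_eq_norm_sq, Complex.ofReal_add]

theorem normSqField_add_ne_zero (hτ : 0 < τ) (x : EuclideanSpace ℝ (Fin n)) :
    normSqField F x + ((1 / τ : ℝ) : ℂ) ≠ 0 := by
  rw [normSqField_add_eq]
  exact Complex.ofReal_ne_zero.2 (by positivity)

theorem norm_phaseWeight (hτ : 0 < τ) (x : EuclideanSpace ℝ (Fin n)) :
    ‖phaseWeight F τ x‖ = (‖F x‖ ^ 2 + 1 / τ)⁻¹ := by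
  rw [phaseWeight, normSqField_add_eq, norm_inv, Complex.norm_real, Real.norm_of_nonneg]
  positivity

theorem ContDiff.normSqField (hF : ContDiff ℝ ∞ F) : ContDiff ℝ ∞ (normSqField F) :=
  Complex.ofRealCLM.contDiff.comp (hF.inner ℝ hF)

theorem ContDiff.phaseWeight (hF : ContDiff ℝ ∞ F) (hτ : 0 < τ) :
    ContDiff ℝ ∞ (phaseWeight F τ) :=
  (hF.normSqField.add contDiff_const).inv fun x => normSqField_add_ne_zero hτ x

theorem ContDiff.phaseCoeff (hF : ContDiff ℝ ∞ F) (hτ : 0 < τ) :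
    ContDiff ℝ ∞ (phaseCoeff F τ) :=
  (contDiff_const.add ((hF.phaseWeight hτ).mul (hF.dirDeriv hF.normSqField))).sub hF.divergence

theorem dirDeriv_phaseWeight (hF : ContDiff ℝ ∞ F) (hτ : 0 < τ) (x : EuclideanSpace ℝ (Fin n)) :
    dirDeriv F (phaseWeight F τ) x =
      -(phaseWeight F τ x ^ 2 * dirDeriv F (normSqField F) x) := by
  have hd : DifferentiableAt ℝ (normSqField F) x := hF.normSqField.differentiable (by simp) x
  have h := dirDeriv_inv (F := F) (hd.add_const ((1 / τ : ℝ) : ℂ))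
    (fun y => normSqField_add_ne_zero hτ y)
  rw [dirDeriv_add hd (differentiableAt_const _), dirDeriv_const, add_zero] at h
  exact h

theorem contDiff_gradient (hf : ContDiff ℝ ∞ f) : ContDiff ℝ ∞ (gradient f) :=
  (InnerProductSpace.toDual ℝ (EuclideanSpace ℝ (Fin n))).symm.contDiff.comp
    (hf.fderiv_right (m := ∞) le_rfl)

theorem ContDiff.cexp_phase (hf : ContDiff ℝ ∞ f) (τ : ℝ) :
    ContDiff ℝ ∞ fun x => Complex.exp (Complex.I * (τ : ℂ) * (f x : ℂ)) :=
  (contDiff_const.mul (Complex.ofRealCLM.contDiff.comp hf)).cexp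

theorem dirDeriv_gradient_cexp_phase (hf : ContDiff ℝ ∞ f) (τ : ℝ)
    (x : EuclideanSpace ℝ (Fin n)) :
    dirDeriv (gradient f) (fun x => Complex.exp (Complex.I * (τ : ℂ) * (f x : ℂ))) x =
      Complex.exp (Complex.I * (τ : ℂ) * (f x : ℂ)) *
        (Complex.I * τ * normSqField (gradient f) x) := by
  have hd : DifferentiableAt ℝ f x := hf.differentiable (by simp) x
  have h1 : HasFDerivAt (fun x => (f x : ℂ)) (Complex.ofRealCLM.comp (fderiv ℝ f x)) x :=
    Complex.ofRealCLM.hasFDerivAt.comp x hd.hasFDerivAt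
  rw [dirDeriv, ((h1.const_mul (Complex.I * (τ : ℂ))).cexp).fderiv]
  have h2 : fderiv ℝ f x (gradient f x) = inner ℝ (gradient f x) (gradient f x) := by
    rw [gradient, InnerProductSpace.toDual_symm_apply]
  simp [h2, normSqField]

/-- One integration by parts along the vector field `w ∇f`, where `w = 1 / (|∇f|² + 1/τ)`. The
term `1/τ` keeps the field smooth at the critical point, and contributes `i w u` to the new
amplitude. -/
theorem integral_cexp_phase_mul (hf : ContDiff ℝ ∞ f) (hu : ContDiff ℝ ∞ u)
    (hc : HasCompactSupport u) (hτ : 0 < τ) :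
    Complex.I * τ * ∫ x, Complex.exp (Complex.I * (τ : ℂ) * (f x : ℂ)) * u x =
      ∫ x, Complex.exp (Complex.I * (τ : ℂ) * (f x : ℂ)) * (phaseWeight (gradient f) τ x *
        (phaseCoeff (gradient f) τ x * u x - dirDeriv (gradient f) u x)) := by
  have hF := contDiff_gradient hf
  set F := gradient f
  set e : EuclideanSpace ℝ (Fin n) → ℂ := fun x =>
    Complex.exp (Complex.I * (τ : ℂ) * (f x : ℂ)) with he_def
  have he : ContDiff ℝ ∞ e := hf.cexp_phase τ
  have hw := hF.phaseWeight hτ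
  have ha := hF.phaseCoeff hτ
  have hcD : HasCompactSupport (dirDeriv F u) :=
    hc.mono' (subset_closure.trans tsupport_dirDeriv_subset)
  have hi1 : Integrable fun x => Complex.I * τ * (e x * u x) :=
    ((he.continuous.mul hu.continuous).integrable_of_hasCompactSupport hc.mul_left).const_mul _
  have hi2 : Integrable fun x => e x * (phaseWeight F τ x *
      (phaseCoeff F τ x * u x - dirDeriv F u x)) := by
    refine Continuous.integrable_of_hasCompactSupport ?_ ?_
    · exact he.continuous.mul (hw.continuous.mul
        ((ha.continuous.mul hu.continuous).sub (hF.dirDeriv hu).continuous))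
    · exact HasCompactSupport.mul_left (HasCompactSupport.mul_left (hc.mul_left.sub hcD))
  have hkey := integral_dirDeriv_add_mul_divergence hF (he.mul (hw.mul hu))
    (HasCompactSupport.mul_left (f := e) (HasCompactSupport.mul_left (f := phaseWeight F τ) hc))
  have hpt : ∀ x, dirDeriv F (fun x => e x * (phaseWeight F τ x * u x)) x +
      e x * (phaseWeight F τ x * u x) * divergence F x =
      Complex.I * τ * (e x * u x) -
        e x * (phaseWeight F τ x * (phaseCoeff F τ x * u x - dirDeriv F u x)) := by
    intro x
    have hdw := hw.differentiable (by simp) x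
    have hdu := hu.differentiable (by simp) x
    rw [dirDeriv_mul (he.differentiable (by simp) x) (hdw.fun_mul hdu), dirDeriv_mul hdw hdu,
      dirDeriv_phaseWeight hF hτ, he_def, dirDeriv_gradient_cexp_phase hf, phaseCoeff]
    have h1 : phaseWeight F τ x * (normSqField F x + ((1 / τ : ℝ) : ℂ)) = 1 :=
      inv_mul_cancel₀ (normSqField_add_ne_zero hτ x)
    have h2 : (τ : ℂ) * ((1 / τ : ℝ) : ℂ) = 1 := by
      rw [← Complex.ofReal_mul, mul_one_div_cancel hτ.ne', Complex.ofReal_one]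
    change _ = Complex.I * τ * (Complex.exp (Complex.I * (τ : ℂ) * (f x : ℂ)) * u x) - _
    -- the term `iτ |∇f|² w u` is `iτ u - i w u`, as `w (|∇f|² + 1/τ) = 1`
    linear_combination (Complex.exp (Complex.I * (τ : ℂ) * (f x : ℂ)) * u x * Complex.I) *
      (τ * h1 - phaseWeight F τ x * h2)
  rw [← integral_const_mul, ← sub_eq_zero, ← integral_sub hi1 hi2, ← hkey]
  exact integral_congr_ae (Eventually.of_forall fun x => (hpt x).symm)

theorem IsCompact.exists_nonneg_bound {α G : Type*} [TopologicalSpace α] [NormedAddCommGroup G]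
    {K : Set α} (hK : IsCompact K) {g : α → G} (hg : Continuous g) :
    ∃ C, 0 ≤ C ∧ ∀ x ∈ K, ‖g x‖ ≤ C := by
  obtain ⟨C, hC⟩ := hK.exists_bound_of_continuousOn hg.continuousOn
  exact ⟨|C|, abs_nonneg _, fun x hx => (hC x hx).trans (le_abs_self _)⟩

/-- The derivatives of `|F|²` along `F`, of order one and two, are quadratic in `F`, so that they
are compensated by one factor of the weight. -/
theorem exists_norm_dirDeriv_normSqField_le (hF : ContDiff ℝ ∞ F) (hK : IsCompact K) :
    ∃ M, 0 ≤ M ∧ ∀ x ∈ K, ‖dirDeriv F (normSqField F) x‖ ≤ M * ‖F x‖ ^ 2 ∧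
      ‖dirDeriv F (dirDeriv F (normSqField F)) x‖ ≤ M * ‖F x‖ ^ 2 := by
  set G : EuclideanSpace ℝ (Fin n) → EuclideanSpace ℝ (Fin n) := fun x => fderiv ℝ F x (F x)
  have hG : ContDiff ℝ ∞ G := (hF.fderiv_right (m := ∞) le_rfl).clm_apply hF
  have hdF : Differentiable ℝ F := hF.differentiable (by simp)
  have hdG : Differentiable ℝ G := hG.differentiable (by simp)
  obtain ⟨M₁, hM₁, hF'⟩ := hK.exists_nonneg_bound (hF.continuous_fderiv (by simp))
  obtain ⟨M₂, hM₂, hG'⟩ := hK.exists_nonneg_bound (hG.continuous_fderiv (by simp))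
  have hD1 : dirDeriv F (normSqField F) =
      fun x => (2 : ℂ) * ((inner ℝ (F x) (G x) : ℝ) : ℂ) := by
    funext x
    change dirDeriv F (fun y => ((inner ℝ (F y) (F y) : ℝ) : ℂ)) x = _
    rw [dirDeriv_inner (hdF x) (hdF x), real_inner_comm]
    push_cast
    ring
  have hin : ContDiff ℝ ∞ fun x => ((inner ℝ (F x) (G x) : ℝ) : ℂ) :=
    Complex.ofRealCLM.contDiff.comp (hF.inner ℝ hG)
  have hD2 : ∀ x, dirDeriv F (dirDeriv F (normSqField F)) x =
      (2 : ℂ) * ((inner ℝ (F x) (fderiv ℝ G x (F x)) + inner ℝ (G x) (G x) : ℝ) : ℂ) := by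
    intro x
    rw [hD1, dirDeriv_mul (differentiableAt_const _) (hin.differentiable (by simp) x),
      dirDeriv_const, dirDeriv_inner (hdF x) (hdG x)]
    ring
  refine ⟨2 * (M₁ + M₂ + M₁ ^ 2), by positivity, fun x hx => ?_⟩
  have hGx : ‖G x‖ ≤ M₁ * ‖F x‖ := (fderiv ℝ F x).le_of_opNorm_le (hF' x hx) _
  have hGGx : ‖fderiv ℝ G x (F x)‖ ≤ M₂ * ‖F x‖ := (fderiv ℝ G x).le_of_opNorm_le (hG' x hx) _
  have hn := norm_nonneg (F x)
  have h1 : ‖(inner ℝ (F x) (G x) : ℝ)‖ ≤ M₁ * ‖F x‖ ^ 2 :=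
    (norm_inner_le_norm _ _).trans (by nlinarith [norm_nonneg (G x)])
  have h2 : ‖(inner ℝ (F x) (fderiv ℝ G x (F x)) : ℝ)‖ ≤ M₂ * ‖F x‖ ^ 2 :=
    (norm_inner_le_norm _ _).trans (by nlinarith)
  have h3 : ‖(inner ℝ (G x) (G x) : ℝ)‖ ≤ M₁ ^ 2 * ‖F x‖ ^ 2 :=
    (norm_inner_le_norm _ _).trans (by
      rw [← mul_pow, ← sq]
      exact pow_le_pow_left₀ (norm_nonneg _) hGx 2)
  have hp1 : 0 ≤ M₁ * ‖F x‖ ^ 2 := by positivity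
  have hp2 : 0 ≤ M₂ * ‖F x‖ ^ 2 := by positivity
  have hp3 : 0 ≤ M₁ ^ 2 * ‖F x‖ ^ 2 := by positivity
  constructor
  · rw [hD1, norm_mul, Complex.norm_real, Complex.norm_two]
    linarith
  · rw [hD2, norm_mul, Complex.norm_real, Complex.norm_two]
    linarith [norm_add_le (inner ℝ (F x) (fderiv ℝ G x (F x)) : ℝ) (inner ℝ (G x) (G x))]

theorem norm_phaseWeight_mul_le (hτ : 0 < τ) {z : ℂ} {M : ℝ} {x : EuclideanSpace ℝ (Fin n)}
    (hM : 0 ≤ M) (hz : ‖z‖ ≤ M * ‖F x‖ ^ 2) : ‖phaseWeight F τ x * z‖ ≤ M := by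
  rw [norm_mul, norm_phaseWeight hτ, inv_mul_le_iff₀ (by positivity)]
  have : 0 ≤ 1 / τ * M := by positivity
  linarith

/-- The amplitude after two integrations by parts is the square of the weight times a function that
is bounded uniformly in `τ`. -/
theorem exists_norm_integral_cexp_phase_mul_le (hf : ContDiff ℝ ∞ f) (hu : ContDiff ℝ ∞ u)
    (hc : HasCompactSupport u) :
    ∃ C, 0 ≤ C ∧ ∀ τ : ℝ, 0 < τ →
      τ ^ 2 * ‖∫ x, Complex.exp (Complex.I * (τ : ℂ) * (f x : ℂ)) * u x‖ ≤
        C * ∫ x in tsupport u, ((‖gradient f x‖ ^ 2 + 1 / τ)⁻¹) ^ 2 := by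
  have hF := contDiff_gradient hf
  set F := gradient f
  set K := tsupport u
  have hK : IsCompact K := hc
  have hDu : ContDiff ℝ ∞ (dirDeriv F u) := hF.dirDeriv hu
  have hDDu : ContDiff ℝ ∞ (dirDeriv F (dirDeriv F u)) := hF.dirDeriv hDu
  have hg := hF.normSqField
  have hDg : ContDiff ℝ ∞ (dirDeriv F (normSqField F)) := hF.dirDeriv hg
  have hdiv : ContDiff ℝ ∞ (divergence F) := hF.divergence
  have hDdiv : ContDiff ℝ ∞ (dirDeriv F (divergence F)) := hF.dirDeriv hdiv
  obtain ⟨M, hM, hMK⟩ := exists_norm_dirDeriv_normSqField_le hF hK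
  obtain ⟨P, hP, hPK⟩ := hK.exists_nonneg_bound hu.continuous
  obtain ⟨P₁, hP₁, hP₁K⟩ := hK.exists_nonneg_bound hDu.continuous
  obtain ⟨P₂, hP₂, hP₂K⟩ := hK.exists_nonneg_bound hDDu.continuous
  obtain ⟨Q, hQ, hQK⟩ := hK.exists_nonneg_bound hdiv.continuous
  obtain ⟨Q₁, hQ₁, hQ₁K⟩ := hK.exists_nonneg_bound hDdiv.continuous
  set A := 1 + M + Q
  set V := A * P + P₁
  set C := A * V + M * V + (((M + M * M + Q₁) * P + A * P₁) + P₂)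
  have hA : 0 ≤ A := by positivity
  have hV : 0 ≤ V := by positivity
  have hC : 0 ≤ C := by positivity
  refine ⟨C, hC, fun τ hτ => ?_⟩
  set w := phaseWeight F τ
  set a := phaseCoeff F τ
  have hw : ContDiff ℝ ∞ w := hF.phaseWeight hτ
  have ha : ContDiff ℝ ∞ a := hF.phaseCoeff hτ
  set v : EuclideanSpace ℝ (Fin n) → ℂ := fun x => a x * u x - dirDeriv F u x
  have hv : ContDiff ℝ ∞ v := (ha.mul hu).sub hDu
  have hcD : HasCompactSupport (dirDeriv F u) :=
    hc.mono' (subset_closure.trans tsupport_dirDeriv_subset)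
  have hcv : HasCompactSupport v := hc.mul_left.sub hcD
  -- the bounded factor of the amplitude
  set B : EuclideanSpace ℝ (Fin n) → ℂ := fun x => a x * v x +
    w x * dirDeriv F (normSqField F) x * v x -
    ((w x * dirDeriv F (dirDeriv F (normSqField F)) x -
      (w x * dirDeriv F (normSqField F) x) * (w x * dirDeriv F (normSqField F) x) -
      dirDeriv F (divergence F) x) * u x + a x * dirDeriv F u x - dirDeriv F (dirDeriv F u) x)
    with hB
  have hdu : Differentiable ℝ u := hu.differentiable (by simp)
  have hda : Differentiable ℝ a := ha.differentiable (by simp)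
  have hdw : Differentiable ℝ w := hw.differentiable (by simp)
  have hdDg := hDg.differentiable (by simp)
  have hDa : ∀ x, dirDeriv F a x = w x * dirDeriv F (dirDeriv F (normSqField F)) x -
      (w x * dirDeriv F (normSqField F) x) * (w x * dirDeriv F (normSqField F) x) -
      dirDeriv F (divergence F) x := by
    intro x
    have h1 : DifferentiableAt ℝ (fun x => w x * dirDeriv F (normSqField F) x) x :=
      (hdw x).fun_mul (hdDg x)
    change dirDeriv F (fun x => Complex.I + w x * dirDeriv F (normSqField F) x -
      divergence F x) x = _
    rw [dirDeriv_sub ((differentiableAt_const _).fun_add h1) (hdiv.differentiable (by simp) x),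
      dirDeriv_add (differentiableAt_const _) h1, dirDeriv_const, dirDeriv_mul (hdw x) (hdDg x),
      dirDeriv_phaseWeight hF hτ]
    ring
  have hBeq : ∀ x, a x * (w x * v x) - dirDeriv F (fun x => w x * v x) x = w x * B x := by
    intro x
    rw [dirDeriv_mul (hdw x) (hv.differentiable (by simp) x), dirDeriv_phaseWeight hF hτ,
      dirDeriv_sub ((hda x).fun_mul (hdu x)) (hDu.differentiable (by simp) x),
      dirDeriv_mul (hda x) (hdu x), hDa]
    simp only [hB, w]
    ring
  have hBC : ∀ x ∈ K, ‖B x‖ ≤ C := by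
    intro x hx
    have h1 : ‖w x * dirDeriv F (normSqField F) x‖ ≤ M :=
      norm_phaseWeight_mul_le hτ hM (hMK x hx).1
    have h2 : ‖w x * dirDeriv F (dirDeriv F (normSqField F)) x‖ ≤ M :=
      norm_phaseWeight_mul_le hτ hM (hMK x hx).2
    have hax : ‖a x‖ ≤ A := norm_sub_le_of_le (norm_add_le_of_le (by simp) h1) (hQK x hx)
    have hvx : ‖v x‖ ≤ V := norm_sub_le_of_le (norm_mul_le_of_le hax (hPK x hx)) (hP₁K x hx)
    refine norm_sub_le_of_le (norm_add_le_of_le (norm_mul_le_of_le hax hvx)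
      (norm_mul_le_of_le h1 hvx)) (norm_sub_le_of_le (norm_add_le_of_le (norm_mul_le_of_le
      (norm_sub_le_of_le (norm_sub_le_of_le h2 (norm_mul_le_of_le h1 h1)) (hQ₁K x hx))
      (hPK x hx)) (norm_mul_le_of_le hax (hP₁K x hx))) (hP₂K x hx))
  have hB0 : ∀ x ∉ K, B x = 0 := by
    intro x hx
    have h1 : dirDeriv F u x = 0 := dirDeriv_eq_zero_of_notMem_tsupport hx
    have h2 : dirDeriv F (dirDeriv F u) x = 0 :=
      dirDeriv_eq_zero_of_notMem_tsupport fun h => hx (tsupport_dirDeriv_subset h)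
    have h3 : u x = 0 := image_eq_zero_of_notMem_tsupport hx
    simp [hB, v, h1, h2, h3]
  have hstep1 := integral_cexp_phase_mul hf hu hc hτ
  have hstep2 := integral_cexp_phase_mul hf (hw.mul hv) (HasCompactSupport.mul_left hcv) hτ
  have htwice : (Complex.I * τ) ^ 2 * ∫ x, Complex.exp (Complex.I * (τ : ℂ) * (f x : ℂ)) * u x =
      ∫ x, Complex.exp (Complex.I * (τ : ℂ) * (f x : ℂ)) * (w x * (w x * B x)) := by
    rw [pow_two, mul_assoc, hstep1, hstep2]
    refine integral_congr_ae (Eventually.of_forall fun x => ?_)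
    change _ * (w x * (a x * (w x * v x) - dirDeriv F (fun x => w x * v x) x)) = _
    rw [hBeq]
  have hnorm : τ ^ 2 * ‖∫ x, Complex.exp (Complex.I * (τ : ℂ) * (f x : ℂ)) * u x‖ =
      ‖(Complex.I * τ) ^ 2 * ∫ x, Complex.exp (Complex.I * (τ : ℂ) * (f x : ℂ)) * u x‖ := by
    rw [norm_mul, norm_pow, norm_mul, Complex.norm_I, one_mul, Complex.norm_real,
      Real.norm_of_nonneg hτ.le]
  rw [hnorm, htwice, ← setIntegral_eq_integral_of_forall_compl_eq_zero (s := K)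
    (fun x hx => by rw [hB0 x hx]; simp), ← integral_const_mul]
  have hcont : Continuous fun x => C * ((‖F x‖ ^ 2 + 1 / τ)⁻¹) ^ 2 := by
    refine continuous_const.mul (Continuous.pow (Continuous.inv₀ ?_ fun x => ?_) 2)
    · exact (hF.continuous.norm.pow 2).add continuous_const
    · positivity
  refine norm_integral_le_of_norm_le (hcont.continuousOn.integrableOn_compact hK) ?_
  refine (ae_restrict_iff' (isClosed_tsupport u).measurableSet).2 (Eventually.of_forall ?_)
  intro x hx
  have hexp : ‖Complex.exp (Complex.I * (τ : ℂ) * (f x : ℂ))‖ = 1 := by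
    rw [mul_assoc, ← Complex.ofReal_mul, mul_comm, Complex.norm_exp_ofReal_mul_I]
  rw [norm_mul, hexp, one_mul, norm_mul, norm_mul, norm_phaseWeight hτ, ← mul_assoc, ← sq, mul_comm]
  exact mul_le_mul_of_nonneg_right (hBC x hx) (by positivity)

/-- In dimension greater than two, an oscillatory integral whose phase has a gradient that vanishes
at most linearly at the origin decays like `τ ^ (-5/4)`. The exponent is not optimal (the truth is
`-n/2`), but it makes the integral an integrable function of `τ`: interpolating between the bounds
`τ` and `1 / |∇f|²` of the weight, its square is at most `τ ^ (3/4)` times the locally integrable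
function `‖x‖ ^ (-5/2)`. -/
theorem exists_norm_integral_cexp_phase_le_rpow (hn : 2 < n) (hf : ContDiff ℝ ∞ f)
    (hu : ContDiff ℝ ∞ u) (hc : HasCompactSupport u) {c : ℝ} (hc0 : 0 < c)
    (hgrad : ∀ x ∈ tsupport u, c * ‖x‖ ≤ ‖gradient f x‖) :
    ∃ C, 0 ≤ C ∧ ∀ τ : ℝ, 0 < τ →
      ‖∫ x, Complex.exp (Complex.I * (τ : ℂ) * (f x : ℂ)) * u x‖ ≤ C * τ ^ (-(5 / 4) : ℝ) := by
  obtain ⟨C, hC, hCb⟩ := exists_norm_integral_cexp_phase_mul_le hf hu hc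
  have hF := contDiff_gradient hf
  have hn' : (2 : ℝ) + 1 ≤ n := by exact_mod_cast hn
  have hint : IntegrableOn (fun x : EuclideanSpace ℝ (Fin n) => ‖x‖ ^ (-(5 / 2) : ℝ))
      (tsupport u) := by
    refine (locallyIntegrable_of_norm_le_rpow (C := 1) (α := 5 / 2)
      ?_ ?_ ?_ ?_).integrableOn_isCompact hc
    · rw [finrank_euclideanSpace_fin]
      omega
    · rw [finrank_euclideanSpace_fin]
      linarith
    · refine Eventually.of_forall fun x => ?_
      rw [one_mul, Real.norm_of_nonneg (by positivity)]
    · exact (measurable_norm.pow_const _).aestronglyMeasurable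
  set A := ∫ x in tsupport u, ‖x‖ ^ (-(5 / 2) : ℝ)
  have hA : 0 ≤ A := integral_nonneg fun x => by positivity
  refine ⟨C * (c ^ (-(5 / 2) : ℝ) * A), by positivity, fun τ hτ => ?_⟩
  -- the power of the norm has the junk value `0` at the origin, which is a null set
  have hnz : ∀ᵐ x : EuclideanSpace ℝ (Fin n), x ≠ 0 := by
    have : Nonempty (Fin n) := ⟨⟨0, by omega⟩⟩
    exact Measure.ae_ne volume 0
  have hle : ∫ x in tsupport u, ((‖gradient f x‖ ^ 2 + 1 / τ)⁻¹) ^ 2 ≤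
      ∫ x in tsupport u, τ ^ (3 / 4 : ℝ) * c ^ (-(5 / 2) : ℝ) * ‖x‖ ^ (-(5 / 2) : ℝ) := by
    refine integral_mono_of_nonneg (Eventually.of_forall fun x => by positivity)
      (hint.const_mul _) ?_
    refine (ae_restrict_iff' (isClosed_tsupport u).measurableSet).2 ?_
    filter_upwards [hnz] with x hx hxK
    have hxn : 0 < ‖x‖ := norm_pos_iff.2 hx
    have hg := hgrad x hxK
    set y := ‖gradient f x‖ ^ 2 + 1 / τ
    have hy : 0 < y := by positivity
    have hy1 : y⁻¹ ≤ τ := by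
      rw [inv_le_comm₀ hy hτ, ← one_div]
      exact le_add_of_nonneg_left (by positivity)
    have hy2 : y⁻¹ ≤ (c * ‖x‖) ^ (-2 : ℝ) := by
      rw [Real.rpow_neg (by positivity), Real.rpow_two]
      refine inv_anti₀ (by positivity) ?_
      have : 0 < 1 / τ := by positivity
      nlinarith [pow_le_pow_left₀ (by positivity) hg 2]
    calc (y⁻¹) ^ 2 = (y⁻¹) ^ (3 / 4 : ℝ) * (y⁻¹) ^ (5 / 4 : ℝ) := by
          rw [← Real.rpow_add (by positivity), ← Real.rpow_two]
          norm_num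
      _ ≤ τ ^ (3 / 4 : ℝ) * ((c * ‖x‖) ^ (-2 : ℝ)) ^ (5 / 4 : ℝ) := by gcongr
      _ = τ ^ (3 / 4 : ℝ) * c ^ (-(5 / 2) : ℝ) * ‖x‖ ^ (-(5 / 2) : ℝ) := by
          rw [← Real.rpow_mul (by positivity), Real.mul_rpow hc0.le hxn.le]
          norm_num
          ring
  rw [integral_const_mul] at hle
  have h1 := (hCb τ hτ).trans (mul_le_mul_of_nonneg_left hle hC)
  have h2 : τ ^ 2 * τ ^ (-(5 / 4) : ℝ) = τ ^ (3 / 4 : ℝ) := by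
    rw [← Real.rpow_two, ← Real.rpow_add hτ]
    norm_num
  refine le_of_mul_le_mul_left (h1.trans (le_of_eq ?_)) (by positivity : 0 < τ ^ 2)
  change C * (τ ^ (3 / 4 : ℝ) * c ^ (-(5 / 2) : ℝ) * A) = _
  rw [← h2]
  ring

end StationaryPhase

/-! ### Nondegenerate critical points -/

section Phase

variable {n : ℕ} {f : EuclideanSpace ℝ (Fin n) → ℝ}

theorem eq_zero_of_fderiv_fderiv_apply_eq_zero (hdet : (hessianMatrix f 0).det ≠ 0)
    {v : EuclideanSpace ℝ (Fin n)} (hv : fderiv ℝ (fderiv ℝ f) 0 v = 0) : v = 0 := by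
  have h : Matrix.vecMul (fun i => v i) (hessianMatrix f 0) = 0 := by
    funext j
    have hsum : v = ∑ i, v i • EuclideanSpace.single i (1 : ℝ) := by
      simpa using ((EuclideanSpace.basisFun (Fin n) ℝ).sum_repr v).symm
    rw [hsum] at hv
    have := congrArg (fun L => L (EuclideanSpace.single j (1 : ℝ))) hv
    simpa [Matrix.vecMul, dotProduct, hessianMatrix] using this
  have h0 := Matrix.eq_zero_of_vecMul_eq_zero hdet h
  ext i
  exact congrFun h0 i

/-- On a compact set where a nondegenerate critical point at the origin is the only critical point,
the gradient is bounded below by a multiple of the distance to the origin. -/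
theorem exists_mul_norm_le_norm_gradient (hf : ContDiff ℝ ∞ f) (hf0 : fderiv ℝ f 0 = 0)
    (hdet : (hessianMatrix f 0).det ≠ 0) {K : Set (EuclideanSpace ℝ (Fin n))} (hK : IsCompact K)
    (hcrit : ∀ x ∈ K, fderiv ℝ f x = 0 → x = 0) :
    ∃ c, 0 < c ∧ ∀ x ∈ K, c * ‖x‖ ≤ ‖gradient f x‖ := by
  have hf' : ContDiff ℝ ∞ (fderiv ℝ f) := hf.fderiv_right (m := ∞) le_rfl
  suffices h : ∃ C, 0 < C ∧ ∀ x ∈ K, ‖x‖ ≤ C * ‖fderiv ℝ f x‖ by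
    obtain ⟨C, hC, hCK⟩ := h
    refine ⟨C⁻¹, by positivity, fun x hx => ?_⟩
    rw [gradient, LinearIsometryEquiv.norm_map, inv_mul_le_iff₀ hC]
    exact hCK x hx
  -- the bound is local: near the origin it is the invertibility of the Hessian
  refine hK.induction_on (p := fun s => ∃ C, 0 < C ∧ ∀ x ∈ s, ‖x‖ ≤ C * ‖fderiv ℝ f x‖)
    ⟨1, one_pos, by simp⟩ ?_ ?_ ?_
  · rintro s t hst ⟨C, hC, h⟩
    exact ⟨C, hC, fun x hx => h x (hst hx)⟩
  · rintro s t ⟨C, hC, h⟩ ⟨C', hC', h'⟩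
    refine ⟨C + C', by positivity, fun x hx => ?_⟩
    have := norm_nonneg (fderiv ℝ f x)
    rcases hx with hx | hx
    · nlinarith [h x hx]
    · nlinarith [h' x hx]
  · intro x hx
    rcases eq_or_ne x 0 with rfl | hx0
    · obtain ⟨k, hk, hanti⟩ := LinearMap.exists_antilipschitzWith
        (fderiv ℝ (fderiv ℝ f) 0).toLinearMap
        (LinearMap.ker_eq_bot'.2 fun v hv => eq_zero_of_fderiv_fderiv_apply_eq_zero hdet hv)
      have hk' : (0 : ℝ) < k := by exact_mod_cast hk
      have hlit := (hf'.differentiable (by simp) 0).hasFDerivAt.isLittleO.def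
        (c := (2 * (k : ℝ))⁻¹) (by positivity)
      refine ⟨_, mem_nhdsWithin_of_mem_nhds hlit, 2 * k, by positivity, fun y hy => ?_⟩
      have hy' : ‖fderiv ℝ f y - fderiv ℝ (fderiv ℝ f) 0 y‖ ≤ (2 * (k : ℝ))⁻¹ * ‖y‖ := by
        simpa [hf0] using hy
      have hl : ‖y‖ ≤ k * ‖fderiv ℝ (fderiv ℝ f) 0 y‖ := by
        simpa using hanti.le_mul_dist y 0
      have h1 : ‖fderiv ℝ (fderiv ℝ f) 0 y‖ ≤ ‖fderiv ℝ f y‖ + (2 * (k : ℝ))⁻¹ * ‖y‖ := by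
        have := norm_sub_norm_le (fderiv ℝ (fderiv ℝ f) 0 y) (fderiv ℝ f y)
        rw [norm_sub_rev] at this
        linarith
      have h2 : (k : ℝ) * ((2 * (k : ℝ))⁻¹ * ‖y‖) = ‖y‖ / 2 := by
        field_simp
      have h3 := mul_le_mul_of_nonneg_left h1 hk'.le
      rw [mul_add, h2] at h3
      linarith
    · have hpos : 0 < ‖fderiv ℝ f x‖ := norm_pos_iff.2 fun h => hx0 (hcrit x hx h)
      have h1 : ∀ᶠ y in 𝓝 x, ‖fderiv ℝ f x‖ / 2 < ‖fderiv ℝ f y‖ :=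
        hf'.continuous.norm.continuousAt.eventually (lt_mem_nhds (half_lt_self hpos))
      have h2 : ∀ᶠ y in 𝓝 x, ‖y‖ < ‖x‖ + 1 :=
        continuous_norm.continuousAt.eventually (gt_mem_nhds (lt_add_one ‖x‖))
      refine ⟨_, mem_nhdsWithin_of_mem_nhds (h1.and h2), (‖x‖ + 1) / (‖fderiv ℝ f x‖ / 2),
        by positivity, fun y hy => ?_⟩
      rw [div_mul_eq_mul_div, le_div_iff₀ (by positivity)]
      exact mul_le_mul hy.2.le hy.1.le (by positivity) (by positivity)

/-- A phase that is smooth near the support of the amplitude can be replaced, without changing it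
there, by one that is smooth everywhere. -/
theorem exists_contDiff_eventuallyEq_nhdsSet {K U : Set (EuclideanSpace ℝ (Fin n))}
    (hK : IsCompact K) (hU : IsOpen U) (hKU : K ⊆ U) (hf : ContDiffOn ℝ ∞ f U) :
    ∃ g : EuclideanSpace ℝ (Fin n) → ℝ, ContDiff ℝ ∞ g ∧ g =ᶠ[𝓝ˢ K] f := by
  obtain ⟨L, hL, hKL, hLU⟩ := exists_compact_between hK hU hKU
  obtain ⟨χ, hχ1, hχ0, -⟩ := exists_contMDiffMap_one_nhds_of_subset_interior
    (n := (⊤ : ℕ∞)) (modelWithCornersSelf ℝ (EuclideanSpace ℝ (Fin n))) hK.isClosed hKL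
  have hχ : ContDiff ℝ ∞ χ := χ.contMDiff.contDiff
  refine ⟨fun x => χ x * f x, contDiff_iff_contDiffAt.2 fun x => ?_, ?_⟩
  · by_cases hx : x ∈ U
    · exact hχ.contDiffAt.mul (hf.contDiffAt (hU.mem_nhds hx))
    · have hev : (fun x => χ x * f x) =ᶠ[𝓝 x] fun _ => 0 := by
        filter_upwards [hL.isClosed.isOpen_compl.mem_nhds fun h => hx (hLU h)] with y hy
        rw [hχ0 y hy, zero_mul]
      exact contDiffAt_const.congr_of_eventuallyEq hev
  · filter_upwards [hχ1] with x hx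
    rw [hx, one_mul]

end Phase

/-! ### Dependence on the parameter -/

section Parameter

variable {n : ℕ} {f : EuclideanSpace ℝ (Fin n) → ℝ} {u : EuclideanSpace ℝ (Fin n) → ℂ}

theorem hasDerivAt_integral_cexp_mul (hf : Continuous f) (hu : Continuous u)
    (hc : HasCompactSupport u) (z : ℂ) :
    HasDerivAt (fun z : ℂ => ∫ x, Complex.exp (z * f x) * u x)
      (∫ x, Complex.exp (z * f x) * (f x * u x)) z := by
  have hfc : Continuous fun x => (f x : ℂ) := Complex.continuous_ofReal.comp hf
  have hF : ∀ z : ℂ, Continuous fun x => Complex.exp (z * f x) * u x := fun z => by fun_prop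
  have hF' : ∀ z : ℂ, Continuous fun x => Complex.exp (z * f x) * (f x * u x) := fun z => by
    fun_prop
  refine (hasDerivAt_integral_of_dominated_loc_of_deriv_le
    (F' := fun z x => Complex.exp (z * f x) * (f x * u x))
    (bound := fun x => Real.exp ((‖z‖ + 1) * ‖f x‖) * ‖(f x : ℂ) * u x‖)
    (Metric.ball_mem_nhds z one_pos) (Eventually.of_forall fun z => (hF z).aestronglyMeasurable)
    ((hF z).integrable_of_hasCompactSupport hc.mul_left) (hF' z).aestronglyMeasurable
    (Eventually.of_forall fun x w hw => ?_) ?_ (Eventually.of_forall fun x w _ => ?_)).2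
  · have hw' : ‖w‖ ≤ ‖z‖ + 1 := by
      have h1 : ‖w - z‖ < 1 := mem_ball_iff_norm.1 hw
      linarith [norm_sub_norm_le w z]
    rw [norm_mul]
    gcongr
    refine (Complex.norm_exp_le_exp_norm _).trans (Real.exp_le_exp.2 ?_)
    rw [norm_mul, Complex.norm_real]
    gcongr
  · refine Continuous.integrable_of_hasCompactSupport (by fun_prop) ?_
    exact HasCompactSupport.mul_left (HasCompactSupport.norm hc.mul_left)
  · have h := (((hasDerivAt_id w).mul_const (f x : ℂ)).cexp).mul_const (u x)
    simpa [mul_assoc] using h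

theorem hasDerivAt_integral_cexp_phase (hf : Continuous f) (hu : Continuous u)
    (hc : HasCompactSupport u) (τ : ℝ) :
    HasDerivAt (fun τ : ℝ => ∫ x, Complex.exp (Complex.I * (τ : ℂ) * (f x : ℂ)) * u x)
      (Complex.I * ∫ x, Complex.exp (Complex.I * (τ : ℂ) * (f x : ℂ)) * (f x * u x)) τ := by
  have h1 : HasDerivAt (fun τ : ℝ => Complex.I * (τ : ℂ)) Complex.I τ := by
    simpa using (Complex.ofRealCLM.hasDerivAt (x := τ)).const_mul Complex.I
  have h2 := (hasDerivAt_integral_cexp_mul hf hu hc (Complex.I * τ)).comp τ h1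
  rw [mul_comm] at h2
  exact h2

/-- As a function of a complex parameter the integral is entire, so that it cannot vanish on a
half-line unless it vanishes at `τ = 0`, where it is the integral of the amplitude. -/
theorem exists_integral_cexp_phase_ne_zero (hf : Continuous f) (hu : Continuous u)
    (hc : HasCompactSupport u) (hu0 : ∫ x, u x ≠ 0) (τ₀ : ℝ) :
    ∃ τ ∈ Ici τ₀, ∫ x, Complex.exp (Complex.I * (τ : ℂ) * (f x : ℂ)) * u x ≠ 0 := by
  by_contra! hcon
  set J : ℂ → ℂ := fun z => ∫ x, Complex.exp (Complex.I * z * (f x : ℂ)) * u x with hJ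
  have hdiff : Differentiable ℂ J := fun z => by
    have h1 : HasDerivAt (fun z : ℂ => Complex.I * z) (Complex.I * 1) z :=
      (hasDerivAt_id z).const_mul Complex.I
    exact ((hasDerivAt_integral_cexp_mul hf hu hc (Complex.I * z)).comp z h1).differentiableAt
  have hana : AnalyticOnNhd ℂ J univ := fun z _ => hdiff.analyticAt z
  have htend : Tendsto (fun t : ℝ => (t : ℂ)) (𝓝[>] τ₀) (𝓝[≠] (τ₀ : ℂ)) := by
    refine tendsto_nhdsWithin_iff.2 ⟨?_, ?_⟩
    · exact (Complex.continuous_ofReal.tendsto τ₀).mono_left nhdsWithin_le_nhds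
    · filter_upwards [self_mem_nhdsWithin] with t ht
      exact fun h => (ne_of_gt ht) (Complex.ofReal_injective h)
  have hfreq : ∃ᶠ z in 𝓝[≠] (τ₀ : ℂ), J z = 0 := by
    refine htend.frequently (Eventually.frequently ?_)
    filter_upwards [self_mem_nhdsWithin] with t ht
    exact hcon t (mem_Ici.2 (le_of_lt ht))
  have hzero := hana.eqOn_zero_of_preconnected_of_frequently_eq_zero isPreconnected_univ
    (mem_univ _) hfreq (mem_univ (0 : ℂ))
  exact hu0 (by simpa [hJ] using hzero)

/-- A differentiable curve whose velocity is continuous and `O(τ ^ (-5/4))` has finite length on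
every half-line. -/
theorem boundedVariationOn_Ici_of_norm_deriv_le {γ γ' : ℝ → ℂ} (hγ : ∀ t, HasDerivAt γ (γ' t) t)
    (hcont : Continuous γ') {C : ℝ} (hC : ∀ t : ℝ, 0 < t → ‖γ' t‖ ≤ C * t ^ (-(5 / 4) : ℝ))
    (a : ℝ) : BoundedVariationOn γ (Ici a) := by
  have hint : IntegrableOn (fun t => ‖γ' t‖) (Ici a) := by
    refine LocallyIntegrableOn.integrableOn_of_isBigO_atTop
      (g := fun t : ℝ => t ^ (-(5 / 4) : ℝ)) ?_ ?_ ?_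
    · exact hcont.norm.locallyIntegrable.locallyIntegrableOn _
    · refine Asymptotics.IsBigO.of_bound C ?_
      filter_upwards [eventually_gt_atTop 0] with t ht
      rw [norm_norm, Real.norm_of_nonneg (Real.rpow_nonneg ht.le _)]
      exact hC t ht
    · exact ⟨Ioi 1, Ioi_mem_atTop 1, integrableOn_Ioi_rpow_of_lt (by norm_num) one_pos⟩
  set m : ℝ → ℝ := fun t => ∫ s in a..t, ‖γ' s‖
  have hii : ∀ s t : ℝ, IntervalIntegrable (fun t => ‖γ' t‖) volume s t := fun s t =>
    hcont.norm.intervalIntegrable s t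
  have hsub : ∀ s t, m t - m s = ∫ r in s..t, ‖γ' r‖ := fun s t =>
    intervalIntegral.integral_interval_sub_left (hii a t) (hii a s)
  have hmono : Monotone m := fun s t hst => sub_nonneg.1 <| by
    rw [hsub]
    exact intervalIntegral.integral_nonneg hst fun _ _ => norm_nonneg _
  have hbound : ∀ t ∈ Ici a, |m t| ≤ ∫ s in Ici a, ‖γ' s‖ := by
    intro t ht
    have h0 : 0 ≤ m t := intervalIntegral.integral_nonneg ht fun _ _ => norm_nonneg _
    rw [abs_of_nonneg h0]
    simp only [m]
    rw [intervalIntegral.integral_of_le ht]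
    exact setIntegral_mono_set hint (Eventually.of_forall fun _ => norm_nonneg _)
      (Eventually.of_forall fun s hs => le_of_lt hs.1)
  refine ((hmono.monotoneOn _).boundedVariationOn_of_abs_le hbound).of_edist_le ?_
  intro s _ t _
  rw [edist_dist, edist_dist]
  refine ENNReal.ofReal_le_ofReal ?_
  rw [dist_comm, dist_eq_norm, dist_comm, Real.dist_eq, hsub,
    ← intervalIntegral.integral_eq_sub_of_hasDerivAt (fun r _ => hγ r)
      (hcont.intervalIntegrable s t)]
  exact intervalIntegral.norm_integral_le_abs_integral_norm

end Parameter

/-! ### Graphs of reflected functions -/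

theorem isRectifiableCurve_reflGraph {X : ℝ → ℝ} (hX : Continuous X)
    (hbv : ∀ a, BoundedVariationOn X (Ici a)) (t₀ : ℝ) :
    IsRectifiableCurve (reflGraph X) (Ioc 0 t₀) := by
  constructor
  · have h1 : ContinuousOn (fun t : ℝ => X (1 / t)) (Ioc 0 t₀) :=
      hX.comp_continuousOn (continuousOn_const.div continuousOn_id fun t ht => ht.1.ne')
    refine (PiLp.continuous_toLp 2 _).comp_continuousOn (continuousOn_pi.2 fun i => ?_)
    fin_cases i
    · exact continuousOn_id
    · exact h1
  · have hid : BoundedVariationOn (fun t : ℝ => t) (Ioc 0 t₀) :=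
      MonotoneOn.boundedVariationOn_of_abs_le (fun _ _ _ _ h => h) (C := t₀)
        fun t ht => by rw [abs_of_pos ht.1]; exact ht.2
    have hanti : AntitoneOn (fun t : ℝ => 1 / t) (Ioc 0 t₀) := fun s hs t _ hst =>
      one_div_le_one_div_of_le hs.1 hst
    have hcomp : BoundedVariationOn (X ∘ fun t : ℝ => 1 / t) (Ioc 0 t₀) :=
      ne_top_of_le_ne_top (hbv (1 / t₀)) (eVariationOn.comp_le_of_antitoneOn X _ hanti
        fun t ht => one_div_le_one_div_of_le ht.1 ht.2)
    refine ne_top_of_le_ne_top (ENNReal.add_ne_top.2 ⟨hid, hcomp⟩) (eVariationOn_le_add ?_)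
    intro s _ t _
    rw [edist_dist, edist_dist, edist_dist, ← ENNReal.ofReal_add dist_nonneg dist_nonneg]
    refine ENNReal.ofReal_le_ofReal ?_
    rw [EuclideanSpace.dist_eq, Fin.sum_univ_two]
    refine Real.sqrt_le_iff.2 ⟨by positivity, ?_⟩
    have h1 : (0 : ℝ) ≤ dist s t := dist_nonneg
    have h2 : (0 : ℝ) ≤ dist (X (1 / s)) (X (1 / t)) := dist_nonneg
    simp only [reflGraph, Function.comp]
    change dist s t ^ 2 + dist (X (1 / s)) (X (1 / t)) ^ 2 ≤ _
    nlinarith [mul_nonneg h1 h2]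

theorem hasOscDim_one {X : ℝ → ℝ} (hX : Continuous X)
    (hbv : ∀ a, BoundedVariationOn X (Ici a)) : HasOscDim X 1 := by
  intro t₀ ht₀
  refine (isRectifiableCurve_reflGraph hX hbv t₀).hasBoxDim_one isPreconnected_Ioc ?_
  refine ⟨_, ⟨t₀, ⟨ht₀, le_rfl⟩, rfl⟩, _, ⟨t₀ / 2, ⟨by linarith, by linarith⟩, rfl⟩, fun h => ?_⟩
  have h0 : t₀ = t₀ / 2 := congrArg (fun z : EuclideanSpace ℝ (Fin 2) => z 0) h
  linarith

/-! ### The curve defined by the oscillatory integral -/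

theorem oscCurve_eq_repr {n : ℕ} (f φ : EuclideanSpace ℝ (Fin n) → ℝ) :
    oscCurve f φ = Complex.orthonormalBasisOneI.repr ∘ oscInt f φ := rfl

theorem proposition2 {n : ℕ} (hn : 2 < n) (f φ : EuclideanSpace ℝ (Fin n) → ℝ)
    (hφ : IsStandardAmplitude φ) (hf : IsStandardPhase f φ)
    (hnondeg : (hessianMatrix f 0).det ≠ 0) :
    (∀ τ₀ : ℝ, IsRectifiableCurve (oscCurve f φ) (Set.Ici τ₀)) ∧
      HasCurveDim f φ 1 ∧
      (∀ t₀ : ℝ, 0 < t₀ →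
        IsRectifiableCurve (reflGraph (oscX f φ)) (Set.Ioc 0 t₀) ∧
        IsRectifiableCurve (reflGraph (oscY f φ)) (Set.Ioc 0 t₀)) ∧
      HasOscDim (oscX f φ) 1 ∧ HasOscDim (oscY f φ) 1 := by
  have hK : IsCompact (tsupport φ) := hφ.hasCompactSupport
  have h0K : (0 : EuclideanSpace ℝ (Fin n)) ∈ tsupport φ := interior_subset hφ.zero_mem
  -- replace the phase by a globally smooth one
  obtain ⟨U, hU, hKU, hfU⟩ := hf.smooth
  obtain ⟨g, hg, hgf⟩ := exists_contDiff_eventuallyEq_nhdsSet hK hU hKU hfU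
  have hgf' : ∀ x ∈ tsupport φ, g =ᶠ[𝓝 x] f := fun x hx => mem_nhdsSet_iff_forall.1 hgf x hx
  have hdg : ∀ x ∈ tsupport φ, fderiv ℝ g x = fderiv ℝ f x := fun x hx => (hgf' x hx).fderiv_eq
  have hdetg : (hessianMatrix g 0).det ≠ 0 := by
    have : hessianMatrix g 0 = hessianMatrix f 0 := by
      simp only [hessianMatrix, (hgf' 0 h0K).fderiv.fderiv_eq]
    rwa [this]
  have hcrit : ∀ x ∈ tsupport φ, fderiv ℝ g x = 0 → x = 0 := by
    intro x hx hx0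
    rw [hdg x hx] at hx0
    by_cases hxi : x ∈ interior (tsupport φ)
    · exact hf.eq_zero_of_critical x hxi hx0
    · exact absurd hx0 (hf.not_critical_frontier x ⟨subset_closure hx, hxi⟩)
  obtain ⟨c, hc, hcK⟩ := exists_mul_norm_le_norm_gradient hg
    ((hdg 0 h0K).trans hf.critical_zero) hdetg hK hcrit
  -- the amplitudes of the integral and of its derivative
  set u : EuclideanSpace ℝ (Fin n) → ℂ := fun x => (φ x : ℂ) with hu_def
  have hu : ContDiff ℝ ∞ u := Complex.ofRealCLM.contDiff.comp hφ.contDiff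
  have huK : tsupport u ⊆ tsupport φ := tsupport_comp_subset (g := Complex.ofReal) rfl φ
  have huc : HasCompactSupport u := hφ.hasCompactSupport.comp_left (g := Complex.ofReal) rfl
  have hgu : ContDiff ℝ ∞ fun x => (g x : ℂ) * u x := (Complex.ofRealCLM.contDiff.comp hg).mul hu
  have hguc : HasCompactSupport fun x => (g x : ℂ) * u x := huc.mul_left
  set J : ℝ → ℂ := fun τ => ∫ x, Complex.exp (Complex.I * (τ : ℂ) * (g x : ℂ)) * u x
  set J' : ℝ → ℂ := fun τ =>
    Complex.I * ∫ x, Complex.exp (Complex.I * (τ : ℂ) * (g x : ℂ)) * (g x * u x)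
  have hI : oscInt f φ = J := by
    funext τ
    refine integral_congr_ae (Eventually.of_forall fun x => ?_)
    by_cases hx : x ∈ tsupport φ
    · simp only [hu_def, (hgf' x hx).eq_of_nhds]
    · simp only [hu_def, image_eq_zero_of_notMem_tsupport hx, Complex.ofReal_zero, mul_zero]
  have hJ : ∀ τ, HasDerivAt J (J' τ) τ :=
    hasDerivAt_integral_cexp_phase hg.continuous hu.continuous huc
  have hJcont : Continuous J := continuous_iff_continuousAt.2 fun τ => (hJ τ).continuousAt
  have hJ'cont : Continuous J' := continuous_const.mul (continuous_iff_continuousAt.2 fun τ =>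
    (hasDerivAt_integral_cexp_phase hg.continuous hgu.continuous hguc τ).continuousAt)
  obtain ⟨C, hC, hJdecay⟩ := exists_norm_integral_cexp_phase_le_rpow hn hg hu huc hc
    fun x hx => hcK x (huK hx)
  obtain ⟨C', hC', hJ'decay⟩ := exists_norm_integral_cexp_phase_le_rpow hn hg hgu hguc hc
    fun x hx => hcK x (huK (tsupport_mul_subset_right hx))
  have hbv : ∀ a, BoundedVariationOn J (Ici a) :=
    boundedVariationOn_Ici_of_norm_deriv_le hJ hJ'cont fun t ht => by
      simpa [J'] using hJ'decay t ht
  have hJ0 : Tendsto J atTop (𝓝 0) := by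
    have h1 : Tendsto (fun τ : ℝ => C * τ ^ (-(5 / 4) : ℝ)) atTop (𝓝 0) := by
      simpa using (tendsto_rpow_neg_atTop (by norm_num : (0 : ℝ) < 5 / 4)).const_mul C
    refine squeeze_zero_norm' ?_ h1
    filter_upwards [eventually_gt_atTop 0] with τ hτ
    exact hJdecay τ hτ
  have hcurve : oscCurve f φ = Complex.orthonormalBasisOneI.repr ∘ J := by
    rw [oscCurve_eq_repr, hI]
  have hrect : ∀ τ₀ : ℝ, IsRectifiableCurve (oscCurve f φ) (Ici τ₀) := by
    intro τ₀
    rw [hcurve]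
    exact ⟨(Complex.orthonormalBasisOneI.repr.continuous.comp hJcont).continuousOn,
      Complex.orthonormalBasisOneI.repr.lipschitz.comp_boundedVariationOn (hbv τ₀)⟩
  have hphi : ∫ x, u x ≠ 0 := by
    obtain ⟨x, hx⟩ : ∃ x, φ x ≠ 0 := by
      by_contra! hcon
      have : tsupport φ = ∅ := tsupport_eq_empty_iff.2 (funext hcon)
      exact (this ▸ h0K : (0 : EuclideanSpace ℝ (Fin n)) ∈ (∅ : Set _))
    have hpos := hφ.contDiff.continuous.integral_pos_of_hasCompactSupport_nonneg_nonzero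
      (μ := volume) hφ.hasCompactSupport hφ.nonneg hx
    rw [hu_def, integral_complex_ofReal]
    exact Complex.ofReal_ne_zero.2 hpos.ne'
  have hcd : HasCurveDim f φ 1 := by
    intro τ₀
    refine (hrect τ₀).hasBoxDim_one isPreconnected_Ici (not_subsingleton_iff.1 fun hsub => ?_)
    obtain ⟨τ, hτ, hne⟩ := exists_integral_cexp_phase_ne_zero hg.continuous hu.continuous huc
      hphi τ₀
    -- a constant value would be the limit at infinity, which is `0`
    have hconst : ∀ s ∈ Ici τ₀, J s = J τ := fun s hs => by
      have := hsub ⟨s, hs, rfl⟩ ⟨τ, hτ, rfl⟩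
      rw [hcurve] at this
      exact Complex.orthonormalBasisOneI.repr.injective this
    refine hne (tendsto_nhds_unique (tendsto_const_nhds.congr' ?_) hJ0)
    filter_upwards [eventually_ge_atTop τ₀] with s hs
    exact (hconst s hs).symm
  have hXc : Continuous (oscX f φ) := by
    have : oscX f φ = Complex.re ∘ J := by rw [← hI]; rfl
    rw [this]
    exact Complex.continuous_re.comp hJcont
  have hYc : Continuous (oscY f φ) := by
    have : oscY f φ = Complex.im ∘ J := by rw [← hI]; rfl
    rw [this]
    exact Complex.continuous_im.comp hJcont
  have hXbv : ∀ a, BoundedVariationOn (oscX f φ) (Ici a) := fun a => by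
    have : oscX f φ = Complex.re ∘ J := by rw [← hI]; rfl
    rw [this]
    exact Complex.reCLM.lipschitz.comp_boundedVariationOn (hbv a)
  have hYbv : ∀ a, BoundedVariationOn (oscY f φ) (Ici a) := fun a => by
    have : oscY f φ = Complex.im ∘ J := by rw [← hI]; rfl
    rw [this]
    exact Complex.imCLM.lipschitz.comp_boundedVariationOn (hbv a)
  exact ⟨hrect, hcd, fun t₀ _ => ⟨isRectifiableCurve_reflGraph hXc hXbv t₀,
    isRectifiableCurve_reflGraph hYc hYbv t₀⟩, hasOscDim_one hXc hXbv, hasOscDim_one hYc hYbv⟩
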